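/- The Shannon game $(G,s,t)$ is played on a finite simple graph $G$ with two distinct vertices $s,t$ designated as terminals. Two players, Short and Cut, alternately colour a previously uncoloured non-terminal vertex until all non-terminal vertices are coloured; Short wins if there is a path from $s$ to $t$ all of whose non-terminal vertices were coloured by Short, and otherwise Cut wins. The game is a \emph{weak link} if each of the two players has a winning strategy when moving first. A weak link is \emph{minimal} if, for every edge $e$ of $G$, Short no longer has a winning strategy as first player in the game $(G-e,s,t)$. The \emph{weight} $w$ is the number of non-terminal vertices of $G$; a \emph{border vertex} is a neighbour of $s$ or of $t$; the \emph{centre} is the set of non-terminal vertices that are adjacent to neither $s$ nor $t$, and $p$ denotes its size. Let $(G,s,t)$ be a minimal weak link of weight $w$ whose centre has size $p$, and let $b$ be a border vertex of degree $d_b$ in $G$. If $w>3$, then $d_b\le p+2$. If $w>5$, then $d_b\le p+1$. -/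

import Mathlib

namespace ShannonGame

/-- The two players: `short` tries to join the terminals, `cut` tries to prevent this. -/
inductive Player where
  | short
  | cut

/-- The opponent of a player. -/
def Player.other : Player → Player
  | .short => .cut
  | .cut => .short

variable {V : Type*}

/-- A position of the game: `c x = some P` if player `P` has coloured (taken) the vertex `x`,
and `c x = none` if nobody has. -/
abbrev Position (V : Type*) := V → Option Player

/-- A vertex that may be played: not a terminal and not yet coloured. -/
def Playable (s t : V) (c : Position V) (x : V) : Prop :=
  x ≠ s ∧ x ≠ t ∧ c x = none

/-- There is a path between the terminals all of whose non-terminal vertices belong to `short`. -/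
def Joined (G : SimpleGraph V) (s t : V) (c : Position V) : Prop :=
  ∃ q : G.Walk s t, ∀ x ∈ q.support, x = s ∨ x = t ∨ c x = some Player.short

/-- The player who has won a completely coloured position. -/
def WonBy (G : SimpleGraph V) (s t : V) (c : Position V) : Player → Prop
  | .short => Joined G s t c
  | .cut => ¬ Joined G s t c

/-- `Forces G s t P Q c`: with player `Q` to move in the position `c`, player `P` has a strategy
that wins the rest of the game. The players alternately colour a playable vertex until none
is left. -/
inductive Forces [DecidableEq V] (G : SimpleGraph V) (s t : V) (P : Player) :
    Player → Position V → Prop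
  | finished (Q : Player) (c : Position V) (hfull : ∀ x, ¬ Playable s t c x)
      (hwon : WonBy G s t c P) : Forces G s t P Q c
  | ownMove (c : Position V) (x : V) (hx : Playable s t c x)
      (hnext : Forces G s t P P.other (Function.update c x (some P))) : Forces G s t P P c
  | otherMove (c : Position V) (hsome : ∃ x, Playable s t c x)
      (hnext : ∀ x, Playable s t c x →
        Forces G s t P P (Function.update c x (some P.other))) : Forces G s t P P.other c

/-- `P` has a winning strategy for the game `(G, s, t)` when moving first. -/
def WinsFirst [DecidableEq V] (G : SimpleGraph V) (s t : V) (P : Player) : Prop :=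
  Forces G s t P P (fun _ => none)

/-- A weak link: both players have a first-player winning strategy. -/
def IsWeakLink [DecidableEq V] (G : SimpleGraph V) (s t : V) : Prop :=
  WinsFirst G s t .short ∧ WinsFirst G s t .cut

/-- A minimal weak link: a weak link that is weakened by the deletion of any single edge, i.e.
after the deletion `short` no longer has a first-player winning strategy. -/
def IsMinimalWeakLink [DecidableEq V] (G : SimpleGraph V) (s t : V) : Prop :=
  IsWeakLink G s t ∧ ∀ e ∈ G.edgeSet, ¬ WinsFirst (G.deleteEdges {e}) s t .short

/-- The weight: the number of non-terminal vertices. -/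
def weight [Fintype V] [DecidableEq V] (s t : V) : ℕ :=
  (Finset.univ.filter fun x : V => x ≠ s ∧ x ≠ t).card

/-- A border vertex: a neighbour of a terminal. -/
def IsBorder (G : SimpleGraph V) (s t b : V) : Prop :=
  G.Adj s b ∨ G.Adj t b

/-- The size of the centre, the set of non-terminal vertices that are in neither border. -/
def centreSize [Fintype V] [DecidableEq V] (G : SimpleGraph V) [DecidableRel G.Adj]
    (s t : V) : ℕ :=
  (Finset.univ.filter fun x : V => x ≠ s ∧ x ≠ t ∧ ¬ G.Adj s x ∧ ¬ G.Adj t x).card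

end ShannonGame

/-! By symmetry let `b` be adjacent to `s`. If Short wins moving first using only the edges inside a
vertex set, minimality forces every edge of `G` into that set. So if `b` is also adjacent to `t`, or
to two neighbours of `t` (a fork), then `G` has edges only on at most three non-terminals; all
others are isolated and lie in the centre, and counting gives the bounds. Otherwise `b` has at most
one neighbour `x` in the border of `t`. An edge between two neighbours of `s` is superfluous, so the
other neighbours of `b` are `s` and centre vertices: `d_b ≤ p + 2`, with equality only if `b` is
adjacent to `x` and to the whole centre.

Equality is impossible for `w > 5` (`IsTightBorder.elim`). No Short win lives on five or fewer
non-terminals, since a vertex outside would be isolated, hence central, hence a neighbour of `b`.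
Excluding forks, direct or after the forcing exchange `b`, `x`, leaves few edges between the borders
and the centre. Now take a winning first move `m` of Short. If all neighbours of `m` but one, `y`,
are within reach of a terminal `r`, then Short at `m` answered by Cut at `y` gains nothing, as paths
through `m` can go through `r`. Short therefore wins from the start without some edge at `m`
(`Forces.drop_move`), against minimality. This excludes every `m` except `b`; there the same
argument applies to Short's next move after Cut's reply at `x`, with `b` as a further choice of `r`.
-/

namespace ShannonGame

variable {V : Type*}

/-! ### Connection of the terminals -/

/-- The vertices a connecting path may use: the terminals and the vertices of `short`. -/
def Usable (s t : V) (c : Position V) (x : V) : Prop :=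
  x = s ∨ x = t ∨ c x = some Player.short

/-- Among the usable vertices, `K` is a union of connected components. -/
def IsClosedUnder (G : SimpleGraph V) (s t : V) (c : Position V) (K : Set V) : Prop :=
  ∀ u v, Usable s t c u → Usable s t c v → u ∈ K → G.Adj u v → v ∈ K

theorem IsClosedUnder.mem_iff {G : SimpleGraph V} {s t : V} {c : Position V} {K : Set V}
    (hK : IsClosedUnder G s t c K) {u v : V} (hu : Usable s t c u) (hv : Usable s t c v)
    (h : G.Adj u v) : u ∈ K ↔ v ∈ K :=
  ⟨fun hm => hK u v hu hv hm h, fun hm => hK v u hv hu hm h.symm⟩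

/-- Closed sets replace walks: rerouting a path then amounts to adjusting membership in a set, with
no walk surgery. -/
theorem joined_iff {G : SimpleGraph V} {s t : V} {c : Position V} :
    Joined G s t c ↔ ∀ K : Set V, IsClosedUnder G s t c K → s ∈ K → t ∈ K := by
  constructor
  · rintro ⟨q, hq⟩ K hK hs
    have key : ∀ (a b : V) (q : G.Walk a b), (∀ x ∈ q.support, Usable s t c x) →
        a ∈ K → b ∈ K := by
      intro a b q
      induction q with
      | nil => exact fun _ h => h
      | cons h q ih =>
        intro hq ha
        rw [SimpleGraph.Walk.support_cons] at hq
        exact ih (fun x hx => hq x (List.mem_cons_of_mem _ hx))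
          (hK _ _ (hq _ List.mem_cons_self)
            (hq _ (List.mem_cons_of_mem _ q.start_mem_support)) ha h)
    exact key s t q hq hs
  · intro h
    refine h {v | ∃ q : G.Walk s v, ∀ x ∈ q.support, Usable s t c x} ?_ ⟨.nil, ?_⟩
    · rintro u v - hv ⟨q, hq⟩ huv
      refine ⟨q.concat huv, fun x hx => ?_⟩
      rw [SimpleGraph.Walk.support_concat, List.mem_append, List.mem_singleton] at hx
      rcases hx with hx | rfl
      exacts [hq x hx, hv]
    · intro x hx
      rw [SimpleGraph.Walk.support_nil, List.mem_singleton] at hx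
      exact Or.inl hx

theorem joined_symm {G : SimpleGraph V} {s t : V} {c : Position V} (h : Joined G s t c) :
    Joined G t s c := by
  obtain ⟨q, hq⟩ := h
  refine ⟨q.reverse, fun x hx => ?_⟩
  rw [SimpleGraph.Walk.support_reverse, List.mem_reverse] at hx
  rcases hq x hx with h | h | h
  exacts [Or.inr (Or.inl h), Or.inl h, Or.inr (Or.inr h)]

theorem wonBy_swap {G : SimpleGraph V} {s t : V} {c : Position V} {P : Player}
    (h : WonBy G s t c P) : WonBy G t s c P := by
  cases P
  · exact joined_symm h
  · exact fun h' => h (joined_symm h')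

theorem Playable.swap {s t : V} {c : Position V} {x : V} (h : Playable s t c x) :
    Playable t s c x := ⟨h.2.1, h.1, h.2.2⟩

theorem joined_mono {G G' : SimpleGraph V} {s t : V} {c c' : Position V} (hG : G ≤ G')
    (hc : ∀ x, c x = some .short → c' x = some .short) (h : Joined G s t c) :
    Joined G' s t c' := by
  rw [joined_iff] at h ⊢
  have hu : ∀ x, Usable s t c x → Usable s t c' x := fun x hx => hx.imp id (Or.imp id (hc x))
  exact fun K hK => h K fun u v h1 h2 h3 h4 => hK u v (hu u h1) (hu v h2) h3 (hG h4)

/-- Deleting an edge does not separate the terminals if its usable ends stay connected. -/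
theorem joined_deleteEdge {G : SimpleGraph V} {s t p q : V} {c : Position V}
    (h : ∀ K, IsClosedUnder (G.deleteEdges {s(p, q)}) s t c K → s ∈ K →
      Usable s t c p → Usable s t c q → (p ∈ K ↔ q ∈ K) ∨ t ∈ K)
    (hj : Joined G s t c) : Joined (G.deleteEdges {s(p, q)}) s t c := by
  rw [joined_iff] at hj ⊢
  intro K hK hs
  by_contra ht
  refine ht (hj K (fun u v hu hv huK huv => ?_) hs)
  by_cases he : s(u, v) = s(p, q)
  · rw [Sym2.eq_iff] at he
    rcases he with ⟨rfl, rfl⟩ | ⟨rfl, rfl⟩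
    · exact ((h K hK hs hu hv).resolve_right ht).1 huK
    · exact ((h K hK hs hv hu).resolve_right ht).2 huK
  · exact hK u v hu hv huK (by simp [SimpleGraph.deleteEdges_adj, huv, he])

/-- A vertex `m` all of whose usable neighbours are equal or adjacent to a usable vertex `r` may be
bypassed. -/
theorem joined_of_bypassed {G : SimpleGraph V} {s t m y r w : V} {c₁ c₂ : Position V}
    (hms : m ≠ s) (hmt : m ≠ t) (hys : y ≠ s) (hyt : y ≠ t) (hrm : r ≠ m)
    (hN : ∀ v, G.Adj m v → v = y ∨ v = r ∨ G.Adj r v)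
    (hy : c₁ y = some .cut) (hr : Usable s t c₁ r)
    (hc : ∀ v, v ≠ m → v ≠ y → c₁ v = c₂ v) (hj : Joined G s t c₁) :
    Joined (G.deleteEdges {s(m, w)}) s t c₂ := by
  rw [joined_iff] at hj ⊢
  intro K hK hs
  have hy1 : ¬ Usable s t c₁ y := by
    rintro (h | h | h)
    exacts [hys h, hyt h, by simp [hy] at h]
  have hu : ∀ v, v ≠ m → Usable s t c₁ v → Usable s t c₂ v := by
    intro v hv h
    refine h.imp id (Or.imp id fun h => ?_)
    rw [← hc v hv]
    · exact h
    · rintro rfl; simp [hy] at h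
  have hadj : ∀ u v, u ≠ m → v ≠ m → G.Adj u v → (G.deleteEdges {s(m, w)}).Adj u v := by
    intro u v hu hv h
    rw [SimpleGraph.deleteEdges_adj]
    refine ⟨h, fun he => ?_⟩
    rw [Set.mem_singleton_iff, Sym2.eq_iff] at he
    rcases he with he | he
    exacts [hu he.1, hv he.2]
  have hnb : ∀ v, G.Adj m v → Usable s t c₁ v → (r ∈ K ↔ v ∈ K) := by
    intro v hv huv
    rcases hN v hv with rfl | rfl | h
    · exact absurd huv hy1
    · exact Iff.rfl
    · exact hK.mem_iff (hu r hrm hr) (hu v hv.ne' huv) (hadj _ _ hrm hv.ne' h)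
  -- This is `K` with the membership of `m` replaced by that of `r`; it is closed in `G` for `c₁`,
  -- whatever colour `c₂` gives to `m`.
  have := hj {v | (v = m → r ∈ K) ∧ (v ≠ m → v ∈ K)} ?_ ⟨fun h => absurd h.symm hms, fun _ => hs⟩
  · exact this.2 hmt.symm
  · rintro u v hu1 hv1 ⟨h1, h2⟩ huv
    by_cases hum : u = m
    · subst hum
      exact ⟨fun h => absurd h huv.ne', fun _ => (hnb v huv hv1).1 (h1 rfl)⟩
    · by_cases hvm : v = m
      · subst hvm
        exact ⟨fun _ => (hnb u huv.symm hu1).2 (h2 hum), fun h => absurd rfl h⟩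
      · exact ⟨fun h => absurd h hvm,
          fun _ => hK u v (hu u hum hu1) (hu v hvm hv1) (h2 hum) (hadj _ _ hum hvm huv)⟩

/-! ### Transfer of strategies between positions and graphs -/

section Game

variable [DecidableEq V] {G G' : SimpleGraph V} {s t : V}

theorem Forces.swap {P Q : Player} {c : Position V} (h : Forces G s t P Q c) :
    Forces G t s P Q c := by
  induction h with
  | finished Q c hfull hwon => exact .finished Q c (fun x hx => hfull x hx.swap) (wonBy_swap hwon)
  | ownMove c x hx _ ih => exact .ownMove c x hx.swap ih
  | otherMove c hsome _ ih =>
    exact .otherMove c (hsome.imp fun _ h => h.swap) fun x hx => ih x hx.swap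

theorem Forces.exists_wonBy {P Q : Player} {c : Position V} (h : Forces G s t P Q c) :
    ∃ c', WonBy G s t c' P := by
  induction h with
  | finished Q c hfull hwon => exact ⟨c, hwon⟩
  | ownMove c x hx _ ih => exact ih
  | otherMove c hsome _ ih => exact hsome.elim fun x hx => ih x hx

theorem IsMinimalWeakLink.swap (h : IsMinimalWeakLink G s t) : IsMinimalWeakLink G t s :=
  ⟨⟨Forces.swap h.1.1, Forces.swap h.1.2⟩, fun e he hw => h.2 e he (Forces.swap hw)⟩

/-- `c` arises from `c₀` by colouring further vertices. -/
def Extends (c₀ c : Position V) : Prop := ∀ v, c₀ v ≠ none → c v = c₀ v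

theorem Extends.update {c₀ c : Position V} (h : Extends c₀ c) {x : V} (hx : c x = none)
    (P : Player) : Extends c₀ (Function.update c x (some P)) := by
  intro v hv
  rw [Function.update_of_ne, h v hv]
  rintro rfl
  exact hv (by rw [← h v hv, hx])

theorem update_agree {c₁ c₂ : Position V} {D : Set V} (hc : ∀ v, v ∉ D → c₁ v = c₂ v)
    (x : V) (o : Option Player) (v : V) (hv : v ∉ D) :
    Function.update c₁ x o v = Function.update c₂ x o v := by
  by_cases h : v = x
  · subst h; simp
  · simp [h, hc v hv]

theorem update_ne_none {c : Position V} {v : V} (h : c v ≠ none) (x : V) (P : Player) :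
    Function.update c x (some P) v ≠ none := by
  by_cases hv : v = x
  · subst hv; simp
  · simpa [hv] using h

/-- A winning strategy of `short` still wins when the colours on `D`, where no moves are left,
are changed in a way that does not affect the outcome. -/
theorem Forces.transfer_coloured {c₀ c₁ c₂ : Position V} {D : Set V} {Q : Player}
    (hpay : ∀ c₁ c₂, Extends c₀ c₁ → (∀ v, v ∉ D → c₁ v = c₂ v) → Joined G s t c₁ →
      Joined G' s t c₂)
    (h : Forces G s t .short Q c₁) (he : Extends c₀ c₁) (hc : ∀ v, v ∉ D → c₁ v = c₂ v)
    (h₁ : ∀ v ∈ D, c₁ v ≠ none) (h₂ : ∀ v ∈ D, c₂ v ≠ none) :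
    Forces G' s t .short Q c₂ := by
  have hpl : ∀ {c₁ c₂ : Position V}, (∀ v, v ∉ D → c₁ v = c₂ v) → (∀ v ∈ D, c₂ v ≠ none) →
      ∀ x, Playable s t c₂ x → Playable s t c₁ x := by
    intro c₁ c₂ hc h₂ x hx
    refine ⟨hx.1, hx.2.1, ?_⟩
    rw [hc x fun hD => h₂ x hD hx.2.2, hx.2.2]
  induction h generalizing c₂ with
  | finished Q c hfull hwon =>
    exact .finished Q c₂ (fun x hx => hfull x (hpl hc h₂ x hx)) (hpay _ _ he hc hwon)
  | ownMove c x hx _ ih =>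
    exact .ownMove c₂ x (hpl (fun v hv => (hc v hv).symm) h₁ x hx)
      (ih (he.update hx.2.2 _) (update_agree hc x _) (fun v hv => update_ne_none (h₁ v hv) _ _)
        (fun v hv => update_ne_none (h₂ v hv) _ _))
  | otherMove c hsome _ ih =>
    refine .otherMove c₂ (hsome.imp fun x hx => hpl (fun v hv => (hc v hv).symm) h₁ x hx) ?_
    intro x hx
    have hx' := hpl hc h₂ x hx
    exact ih x hx' (he.update hx'.2.2 _) (update_agree hc x _)
      (fun v hv => update_ne_none (h₁ v hv) _ _) (fun v hv => update_ne_none (h₂ v hv) _ _)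

theorem Forces.mono {c : Position V} {Q : Player}
    (hpay : ∀ c', Extends c c' → Joined G s t c' → Joined G' s t c')
    (h : Forces G s t .short Q c) : Forces G' s t .short Q c := by
  refine h.transfer_coloured (c₀ := c) (D := ∅) ?_ (fun _ _ => rfl) (fun _ _ => rfl)
    (by simp) (by simp)
  intro c₁ c₂ he hc hj
  obtain rfl : c₁ = c₂ := funext fun v => hc v (by simp)
  exact hpay c₁ he hj

theorem WinsFirst.mono (hG : G ≤ G') (h : WinsFirst G s t .short) : WinsFirst G' s t .short :=
  Forces.mono (fun _ _ => joined_mono hG fun _ => id) h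

theorem Forces.reply {c : Position V} (h : Forces G s t .short .cut c) {z : V}
    (hz : Playable s t c z) : Forces G s t .short .short (Function.update c z (some .cut)) := by
  generalize hQ : Player.cut = Q at h
  cases h with
  | finished _ _ hfull _ => exact absurd hz (hfull z)
  | ownMove => cases hQ
  | otherMove _ _ hnext => exact hnext z hz

theorem Forces.exists_move {c : Position V} (h : Forces G s t .short .short c)
    (hc : ∃ z, Playable s t c z) :
    ∃ m, Playable s t c m ∧ Forces G s t .short .cut (Function.update c m (some .short)) := by
  have key : ∀ Q, Q = Player.short → Forces G s t .short Q c →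
      ∃ m, Playable s t c m ∧
        Forces G s t .short .cut (Function.update c m (some .short)) := by
    intro Q hQ h
    cases h with
    | finished _ _ hfull _ => exact absurd hc (not_exists.2 hfull)
    | ownMove _ x hx hnext => exact ⟨x, hx, hnext⟩
    | otherMove => cases hQ
  exact key _ rfl h

variable [Fintype V]

/-- Later moves never recolour a vertex, so an existing connection survives any play; the induction
is on the number of uncoloured vertices. -/
theorem forces_of_joined {c : Position V} (Q : Player) (h : Joined G s t c) :
    Forces G s t .short Q c := by
  induction hn : (Finset.univ.filter fun v => c v = none).card using Nat.strong_induction_on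
    generalizing c Q with
  | _ n ih =>
    by_cases hfull : ∀ x, ¬ Playable s t c x
    · exact .finished Q c hfull h
    · have key : ∀ x, Playable s t c x → ∀ P Q,
          Forces G s t .short Q (Function.update c x (some P)) := by
        intro x hx P Q
        refine ih _ ?_ Q (joined_mono le_rfl ?_ h) rfl
        · rw [← hn]
          refine Finset.card_lt_card ((Finset.ssubset_iff_of_subset ?_).2 ⟨x, ?_, ?_⟩)
          · intro v hv
            simp only [Finset.mem_filter, Finset.mem_univ, true_and] at hv ⊢
            by_contra h0
            exact update_ne_none h0 _ _ hv
          · simpa using hx.2.2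
          · simp
        · intro v hv
          rw [Function.update_of_ne, hv]
          rintro rfl
          rw [hx.2.2] at hv
          cases hv
      push Not at hfull
      cases Q
      · obtain ⟨x, hx⟩ := hfull
        exact .ownMove c x hx (key x hx _ _)
      · exact .otherMove c hfull fun x hx => key x hx _ _

/-- An exchange of moves on `m` and `y` that does not help `short` may be omitted. -/
theorem Forces.transfer_free {c₀ c₁ c₂ : Position V} {m y : V} {Q : Player} (hmy : m ≠ y)
    (hm : m ≠ s ∧ m ≠ t) (hy : y ≠ s ∧ y ≠ t)
    (hpay : ∀ c₁ c₂, Extends c₀ c₁ → (∀ v, v ∉ ({m, y} : Set V) → c₁ v = c₂ v) →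
      Joined G s t c₁ → Joined G' s t c₂)
    (h : Forces G s t .short Q c₁) (he : Extends c₀ c₁)
    (hc : ∀ v, v ∉ ({m, y} : Set V) → c₁ v = c₂ v)
    (h₁ : c₁ m ≠ none ∧ c₁ y ≠ none) (h₂ : c₂ m = none ∧ c₂ y = none) :
    Forces G' s t .short Q c₂ := by
  have hnot : ∀ {c : Position V}, c m ≠ none ∧ c y ≠ none → ∀ x, c x = none →
      x ∉ ({m, y} : Set V) := by
    rintro c h x hx (rfl | rfl)
    exacts [h.1 hx, h.2 hx]
  have hmem : ∀ {c : Position V}, c m ≠ none ∧ c y ≠ none → ∀ v ∈ ({m, y} : Set V),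
      c v ≠ none := by
    rintro c h v (rfl | rfl)
    exacts [h.1, h.2]
  have hupd : ∀ {c : Position V} {x : V} {P : Player}, c m = none ∧ c y = none →
      x ∉ ({m, y} : Set V) →
      Function.update c x (some P) m = none ∧ Function.update c x (some P) y = none := by
    intro c x P h hx
    simp only [Set.mem_insert_iff, Set.mem_singleton_iff, not_or] at hx
    rw [Function.update_of_ne (Ne.symm hx.1), Function.update_of_ne (Ne.symm hx.2)]
    exact h
  induction h generalizing c₂ with
  -- The imitated game is over while `m` and `y` are still free in `c₂`, but the connection already
  -- exists there.
  | finished Q c hfull hwon => exact forces_of_joined Q (hpay _ _ he hc hwon)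
  | ownMove c x hx _ ih =>
    have hxD := hnot h₁ x hx.2.2
    exact .ownMove c₂ x ⟨hx.1, hx.2.1, by rw [← hc x hxD, hx.2.2]⟩
      (ih (he.update hx.2.2 _) (update_agree hc x _)
        ⟨update_ne_none h₁.1 _ _, update_ne_none h₁.2 _ _⟩ (hupd h₂ hxD))
  | otherMove c hsome hnext ih =>
    refine .otherMove c₂ ⟨m, hm.1, hm.2, h₂.1⟩ fun x hx => ?_
    -- `m` and `y` form a pair: when Cut takes one, Short takes the other. Both are then coloured,
    -- and the outcome does not depend on how.
    have hfill : ∀ {p q : V} (P P' : Player), p ≠ q → ({m, y} : Set V) = {p, q} →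
        Forces G' s t .short Player.short.other
          (Function.update (Function.update c₂ p (some P)) q (some P')) := by
      intro p q P P' hpq hD
      refine Forces.transfer_coloured hpay (.otherMove c hsome hnext) he ?_ (hmem h₁) ?_
      · intro v hv
        have hv' := hv
        rw [hD] at hv'
        simp only [Set.mem_insert_iff, Set.mem_singleton_iff, not_or] at hv'
        rw [Function.update_of_ne hv'.2, Function.update_of_ne hv'.1, hc v hv]
      · rw [hD]
        rintro v (rfl | rfl)
        · exact update_ne_none (by simp) _ _
        · simp
    by_cases hxm : x = m
    · subst hxm
      exact .ownMove _ y ⟨hy.1, hy.2, by rw [Function.update_of_ne hmy.symm, h₂.2]⟩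
        (hfill _ _ hmy rfl)
    by_cases hxy : x = y
    · subst hxy
      exact .ownMove _ m ⟨hm.1, hm.2, by rw [Function.update_of_ne hmy, h₂.1]⟩
        (hfill _ _ hmy.symm (Set.pair_comm _ _))
    have hxD : x ∉ ({m, y} : Set V) := by simp [hxm, hxy]
    have hx0 : c x = none := by rw [hc x hxD, hx.2.2]
    exact ih x ⟨hx.1, hx.2.1, hx0⟩ (he.update hx0 _) (update_agree hc x _)
      ⟨update_ne_none h₁.1 _ _, update_ne_none h₁.2 _ _⟩ (hupd h₂ hxD)

/-- If `short` wins after taking `m` and losing `y` in return, although `m` can then be bypassed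
through `r`, then `short` also wins without this exchange and without any single edge at `m`. -/
theorem Forces.drop_exchange {c : Position V} {m y r w : V} (hmy : m ≠ y) (hm : Playable s t c m)
    (hy : Playable s t c y) (hrm : r ≠ m) (hr : Usable s t c r)
    (hN : ∀ v, G.Adj m v → v = y ∨ v = r ∨ G.Adj r v)
    (h : Forces G s t .short .short
      (Function.update (Function.update c m (some .short)) y (some .cut))) :
    Forces (G.deleteEdges {s(m, w)}) s t .short .short c := by
  set c₀ := Function.update (Function.update c m (some .short)) y (some .cut) with hc₀
  have hc₀y : c₀ y = some .cut := by simp [hc₀]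
  have hc₀m : c₀ m = some .short := by simp [hc₀, hmy]
  have hoff : ∀ v, v ∉ ({m, y} : Set V) → c₀ v = c v := by
    intro v hv
    simp only [Set.mem_insert_iff, Set.mem_singleton_iff, not_or] at hv
    simp [hc₀, hv.1, hv.2]
  refine h.transfer_free (c₀ := c₀) hmy ⟨hm.1, hm.2.1⟩ ⟨hy.1, hy.2.1⟩ ?_ (fun _ _ => rfl) hoff
    ⟨by simp [hc₀m], by simp [hc₀y]⟩ ⟨hm.2.2, hy.2.2⟩
  intro c₁ c₂ he hc hj
  refine joined_of_bypassed hm.1 hm.2.1 hy.1 hy.2.1 hrm hN ?_ ?_ ?_ hj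
  · rw [he y (by simp [hc₀y]), hc₀y]
  · refine hr.imp id (Or.imp id fun hr => ?_)
    have hry : r ≠ y := by rintro rfl; simp [hy.2.2] at hr
    have : c₀ r = some .short := by rw [hoff r (by simp [hrm, hry]), hr]
    rw [he r (by simp [this]), this]
  · exact fun v hv1 hv2 => hc v (by simp [hv1, hv2])

/-- If taking `u` completes a connection, then `short` may do so after any other move of `cut`. -/
theorem forces_of_threat_ignored {c : Position V} {u z : V} (huz : u ≠ z) (hu : Playable s t c u)
    (hz : Playable s t c z) (hj : Joined G s t (Function.update c u (some .short))) :
    Forces G s t .short .short (Function.update c z (some .cut)) := by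
  refine .ownMove _ u ⟨hu.1, hu.2.1, by rw [Function.update_of_ne huz, hu.2.2]⟩
    (forces_of_joined _ (joined_mono le_rfl (fun x hx => ?_) hj))
  by_cases hxu : x = u
  · subst hxu; simp
  · rw [Function.update_of_ne hxu] at hx ⊢
    rw [Function.update_of_ne, hx]
    rintro rfl
    rw [hz.2.2] at hx
    cases hx

/-- If taking `u` completes a connection, then `cut` has to take it. -/
theorem forces_of_threat {c : Position V} {u : V} (hu : Playable s t c u)
    (hj : Joined G s t (Function.update c u (some .short)))
    (h : Forces G s t .short .short (Function.update c u (some .cut))) :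
    Forces G s t .short .cut c := by
  refine .otherMove c ⟨u, hu⟩ fun z hz => ?_
  by_cases hzu : u = z
  · exact hzu ▸ h
  · exact forces_of_threat_ignored hzu hu hz hj

/-- Two different vertices each of which completes a connection are a double threat. -/
theorem forces_of_double_threat {c : Position V} {u v : V} (huv : u ≠ v)
    (hu : Playable s t c u) (hv : Playable s t c v)
    (hju : Joined G s t (Function.update c u (some .short)))
    (hjv : Joined G s t (Function.update c v (some .short))) : Forces G s t .short .cut c :=
  forces_of_threat hu hju (forces_of_threat_ignored huv.symm hv hu hjv)

end Game

end ShannonGame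

/-! ### Consequences of minimality -/

namespace ShannonGame

variable {V : Type*} {G G' : SimpleGraph V} {s t : V}

/-- The edges of `G` with both ends in `S`. -/
def within (G : SimpleGraph V) (S : Set V) : SimpleGraph V where
  Adj u v := G.Adj u v ∧ u ∈ S ∧ v ∈ S
  symm := ⟨fun _ _ h => ⟨h.1.symm, h.2.2, h.2.1⟩⟩
  loopless := ⟨fun _ h => h.1.ne rfl⟩

theorem joined_of_path₁ {u : V} {c : Position V} (hu : c u = some .short) (h₁ : G.Adj s u)
    (h₂ : G.Adj u t) : Joined G s t c :=
  joined_iff.2 fun _ hK hs =>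
    (hK.mem_iff (.inr (.inr hu)) (.inr (.inl rfl)) h₂).1
      ((hK.mem_iff (.inl rfl) (.inr (.inr hu)) h₁).1 hs)

theorem joined_of_path₂ {u v : V} {c : Position V} (hu : c u = some .short)
    (hv : c v = some .short) (h₁ : G.Adj s u) (h₂ : G.Adj u v) (h₃ : G.Adj v t) :
    Joined G s t c :=
  joined_iff.2 fun _ hK hs =>
    (hK.mem_iff (.inr (.inr hv)) (.inr (.inl rfl)) h₃).1
      ((hK.mem_iff (.inr (.inr hu)) (.inr (.inr hv)) h₂).1
        ((hK.mem_iff (.inl rfl) (.inr (.inr hu)) h₁).1 hs))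

theorem joined_of_path₃ {u v w : V} {c : Position V} (hu : c u = some .short)
    (hv : c v = some .short) (hw : c w = some .short) (h₁ : G.Adj s u) (h₂ : G.Adj u v)
    (h₃ : G.Adj v w) (h₄ : G.Adj w t) : Joined G s t c :=
  joined_iff.2 fun _ hK hs =>
    (hK.mem_iff (.inr (.inr hw)) (.inr (.inl rfl)) h₄).1
      ((hK.mem_iff (.inr (.inr hv)) (.inr (.inr hw)) h₃).1
        ((hK.mem_iff (.inr (.inr hu)) (.inr (.inr hv)) h₂).1
          ((hK.mem_iff (.inl rfl) (.inr (.inr hu)) h₁).1 hs)))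

theorem deleteEdge_adj {p q u v : V} (h : G.Adj u v) (h₁ : ¬(u = p ∧ v = q))
    (h₂ : ¬(u = q ∧ v = p)) : (G.deleteEdges {s(p, q)}).Adj u v := by
  rw [SimpleGraph.deleteEdges_adj, Set.mem_singleton_iff, Sym2.eq_iff]
  exact ⟨h, not_or.2 ⟨h₁, h₂⟩⟩

variable [DecidableEq V]

/-- An edge missing from `G'` could be deleted from `G` while Short's win in `G'` persists. -/
theorem IsMinimalWeakLink.adj_of_winsFirst (hG : IsMinimalWeakLink G s t) (hle : G' ≤ G)
    (hw : WinsFirst G' s t .short) {u v : V} (h : G.Adj u v) : G'.Adj u v := by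
  by_contra h'
  refine hG.2 s(u, v) h (hw.mono fun p q hpq => ?_)
  rw [SimpleGraph.deleteEdges_adj]
  refine ⟨hle hpq, fun he => ?_⟩
  rw [Set.mem_singleton_iff, Sym2.eq_iff] at he
  rcases he with ⟨rfl, rfl⟩ | ⟨rfl, rfl⟩
  exacts [h' hpq, h' hpq.symm]

theorem IsMinimalWeakLink.mem_of_adj (hG : IsMinimalWeakLink G s t) {S : Set V}
    (hw : WinsFirst (within G S) s t .short) {u v : V} (h : G.Adj u v) : v ∈ S :=
  (hG.adj_of_winsFirst (G' := within G S) (fun _ _ h => h.1) hw h).2.2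

theorem IsMinimalWeakLink.not_adj_terminals (hG : IsMinimalWeakLink G s t) : ¬ G.Adj s t := by
  intro h
  obtain ⟨c, hc⟩ := Forces.exists_wonBy hG.1.2
  exact hc (joined_iff.2 fun K hK hs => hK s t (.inl rfl) (.inr (.inl rfl)) hs h)

/-- If `m` is a winning first move in a minimal weak link, then no edge is superfluous once `m`
belongs to `short`. -/
theorem IsMinimalWeakLink.not_superfluous (hG : IsMinimalWeakLink G s t) {m p q : V}
    (hm : Forces G s t .short .cut (Function.update (fun _ => none) m (some .short)))
    (hms : m ≠ s ∧ m ≠ t) (hpq : G.Adj p q)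
    (h : ∀ c : Position V, c m = some .short → ∀ K,
      IsClosedUnder (G.deleteEdges {s(p, q)}) s t c K → s ∈ K →
      Usable s t c p → Usable s t c q → (p ∈ K ↔ q ∈ K) ∨ t ∈ K) : False := by
  refine hG.2 s(p, q) hpq (.ownMove _ m ⟨hms.1, hms.2, rfl⟩ (hm.mono fun c hc hj => ?_))
  refine joined_deleteEdge (h c ?_) hj
  rw [hc m (by simp)]
  simp

/-- Such an edge would be superfluous: when usable, both ends are already connected through `s`. -/
theorem IsMinimalWeakLink.not_adj_of_adj_left (hG : IsMinimalWeakLink G s t) {u v : V}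
    (hu : G.Adj s u) (hv : G.Adj s v) : ¬ G.Adj u v := by
  intro huv
  refine hG.2 s(u, v) huv (Forces.mono (fun c _ hj => joined_deleteEdge ?_ hj) hG.1.1)
  intro K hK _ hu' hv'
  left
  have h1 := hK.mem_iff (.inl rfl) hu'
    (deleteEdge_adj hu (fun h => hu.ne h.1) (fun h => hv.ne h.1))
  have h2 := hK.mem_iff (.inl rfl) hv'
    (deleteEdge_adj hv (fun h => hu.ne h.1) (fun h => hv.ne h.1))
  exact h1.symm.trans h2

variable [Fintype V]

/-! ### Quick wins of Short, and idle moves -/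

theorem winsFirst_of_common_neighbour {b : V} (h₁ : G.Adj s b) (h₂ : G.Adj b t) :
    WinsFirst G s t .short :=
  .ownMove _ b ⟨h₁.ne', h₂.ne, rfl⟩ (forces_of_joined _ (joined_of_path₁ (by simp) h₁ h₂))

/-- After taking `b`, `short` can complete a connection both at `u` and at `v`. -/
theorem winsFirst_of_fork {b u v : V} (hb : b ≠ s ∧ b ≠ t) (hu : u ≠ s ∧ u ≠ t)
    (hv : v ≠ s ∧ v ≠ t) (hbu : b ≠ u) (hbv : b ≠ v) (huv : u ≠ v)
    (hju : ∀ c : Position V, c b = some .short → c u = some .short → Joined G s t c)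
    (hjv : ∀ c : Position V, c b = some .short → c v = some .short → Joined G s t c) :
    WinsFirst G s t .short := by
  refine .ownMove _ b ⟨hb.1, hb.2, rfl⟩ (forces_of_double_threat huv
    ⟨hu.1, hu.2, by simp [hbu.symm]⟩ ⟨hv.1, hv.2, by simp [hbv.symm]⟩ ?_ ?_)
  · exact hju _ (by simp [hbu]) (by simp)
  · exact hjv _ (by simp [hbv]) (by simp)

/-- After taking `b` and forcing `cut` to answer at `x`, `short` takes `d` and can complete a
connection both at `u` and at `v`. -/
theorem winsFirst_of_delayed_fork {b x d u v : V} (hx : x ≠ d) (hu : u ≠ s ∧ u ≠ t)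
    (hv : v ≠ s ∧ v ≠ t) (hd : d ≠ s ∧ d ≠ t) (hbd : b ≠ d) (hbu : b ≠ u) (hbv : b ≠ v)
    (hxu : x ≠ u) (hxv : x ≠ v) (hdu : d ≠ u) (hdv : d ≠ v) (huv : u ≠ v) (hbt : b ≠ t)
    (hxs : x ≠ s) (h₁ : G.Adj s b) (h₂ : G.Adj b x) (h₃ : G.Adj x t)
    (hju : ∀ c : Position V, c b = some .short → c d = some .short → c u = some .short →
      Joined G s t c)
    (hjv : ∀ c : Position V, c b = some .short → c d = some .short → c v = some .short →
      Joined G s t c) : WinsFirst G s t .short := by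
  refine .ownMove _ b ⟨h₁.ne', hbt, rfl⟩ (forces_of_threat (u := x)
    ⟨hxs, h₃.ne, by simp [h₂.ne']⟩ ?_ (.ownMove _ d ⟨hd.1, hd.2, by simp [hx.symm, hbd.symm]⟩
      (forces_of_double_threat huv ⟨hu.1, hu.2, ?_⟩ ⟨hv.1, hv.2, ?_⟩ ?_ ?_)))
  · exact joined_of_path₂ (by simp [h₂.ne]) (by simp) h₁ h₂ h₃
  · simp [hdu.symm, hxu.symm, hbu.symm]
  · simp [hdv.symm, hxv.symm, hbv.symm]
  · exact hju _ (by simp [hbu, h₂.ne, hbd]) (by simp [hdu]) (by simp)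
  · exact hjv _ (by simp [hbv, h₂.ne, hbd]) (by simp [hdv]) (by simp)

/-- If `m` has at most one neighbour that is not within reach of the usable vertex `r`, then a win
of `short` that starts at `m` does not depend on any single edge at `m`. -/
theorem Forces.drop_move {c : Position V} {m r w : V} (hm : Playable s t c m)
    (hfree : ∃ u, u ≠ m ∧ Playable s t c u) (hrm : r ≠ m) (hr : Usable s t c r)
    (hplay : ∀ v, G.Adj m v → v ≠ r → ¬ G.Adj r v → Playable s t c v)
    (huniq : ∀ v v', G.Adj m v → v ≠ r → ¬ G.Adj r v → G.Adj m v' → v' ≠ r → ¬ G.Adj r v' →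
      v = v')
    (h : Forces G s t .short .cut (Function.update c m (some .short))) :
    Forces (G.deleteEdges {s(m, w)}) s t .short .short c := by
  obtain ⟨y, hym, hy, hN⟩ : ∃ y, y ≠ m ∧ Playable s t c y ∧
      ∀ v, G.Adj m v → v = y ∨ v = r ∨ G.Adj r v := by
    by_cases hex : ∃ y, G.Adj m y ∧ y ≠ r ∧ ¬ G.Adj r y
    · obtain ⟨y, h1, h2, h3⟩ := hex
      refine ⟨y, h1.ne', hplay y h1 h2 h3, fun v hv => ?_⟩
      by_contra! hcon
      exact hcon.1 (huniq v y hv hcon.2.1 hcon.2.2 h1 h2 h3)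
    · push Not at hex
      obtain ⟨y, hym, hy⟩ := hfree
      refine ⟨y, hym, hy, fun v hv => .inr ?_⟩
      by_cases hvr : v = r
      exacts [.inl hvr, .inr (hex v hv hvr)]
  refine Forces.drop_exchange hym.symm hm hy hrm hr hN (h.reply ⟨hy.1, hy.2.1, ?_⟩)
  rw [Function.update_of_ne hym, hy.2.2]

theorem exists_nonterminal_notMem (T : Finset V) (hT : T.card < weight s t) :
    ∃ u, u ≠ s ∧ u ≠ t ∧ u ∉ T := by
  by_contra! h
  refine absurd (Finset.card_le_card ?_) hT.not_ge
  intro u hu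
  rw [Finset.mem_filter] at hu
  exact h u hu.2.1 hu.2.2

/-! ### Local structure around a tight border vertex -/

/-- A neighbour `b` of `s` in a minimal weak link of weight more than five that is adjacent to the
whole centre and to exactly one neighbour `x` of `t`. The results below show that there is none. -/
structure IsTightBorder (G : SimpleGraph V) (s t b x : V) : Prop where
  minimal : IsMinimalWeakLink G s t
  adj_left : G.Adj s b
  not_adj_right : ¬ G.Adj t b
  adj_mate : G.Adj b x
  mate_adj_right : G.Adj t x
  mate_unique : ∀ v, G.Adj b v → G.Adj t v → v = x
  adj_centre : ∀ v, v ≠ s → v ≠ t → ¬ G.Adj s v → ¬ G.Adj t v → G.Adj b v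
  weight_lt : 5 < weight s t

namespace IsTightBorder

variable {b x : V}

/-- A non-terminal outside `T` would be isolated by minimality, hence central, hence adjacent to
`b`. The bound five is the number of vertices in a delayed fork. -/
theorem not_winsFirst_within (h : IsTightBorder G s t b x) (T : Finset V) (hT : T.card ≤ 5) :
    ¬ WinsFirst (within G {v | v = s ∨ v = t ∨ v ∈ T}) s t .short := by
  intro hw
  obtain ⟨u, hus, hut, huT⟩ := exists_nonterminal_notMem (s := s) (t := t) T
    (lt_of_le_of_lt hT h.weight_lt)
  have hu : ∀ v, ¬ G.Adj v u := by
    intro v hv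
    rcases h.minimal.mem_of_adj hw hv with h | h | h
    exacts [hus h, hut h, huT h]
  exact hu b (h.adj_centre u hus hut (hu s) (hu t))

theorem not_adj_both (h : IsTightBorder G s t b x) {u : V} (h₁ : G.Adj s u) : ¬ G.Adj t u := by
  intro h₂
  refine h.not_winsFirst_within {u} (by simp) (winsFirst_of_common_neighbour (b := u) ?_ ?_)
  · exact ⟨h₁, by simp, by simp⟩
  · exact ⟨h₂.symm, by simp, by simp⟩

theorem right_unique_of_left (h : IsTightBorder G s t b x) {a y y' : V} (ha : G.Adj s a)
    (hy : G.Adj t y) (hy' : G.Adj t y') (hay : G.Adj a y) (hay' : G.Adj a y') : y = y' := by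
  by_contra hne
  have hs : ∀ z, G.Adj t z → z ≠ s := by
    rintro _ hz rfl
    exact h.minimal.not_adj_terminals hz.symm
  refine h.not_winsFirst_within {a, y, y'} (Finset.card_le_three.trans (by norm_num)) ?_
  refine winsFirst_of_fork (b := a) (u := y) (v := y') ⟨ha.ne', ?_⟩ ⟨hs y hy, hy.ne'⟩
    ⟨hs y' hy', hy'.ne'⟩ hay.ne hay'.ne hne ?_ ?_
  · rintro rfl
    exact h.minimal.not_adj_terminals ha
  · exact fun c h₁ h₂ => joined_of_path₂ h₁ h₂ ⟨ha, by simp, by simp⟩ ⟨hay, by simp, by simp⟩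
      ⟨hy.symm, by simp, by simp⟩
  · exact fun c h₁ h₂ => joined_of_path₂ h₁ h₂ ⟨ha, by simp, by simp⟩ ⟨hay', by simp, by simp⟩
      ⟨hy'.symm, by simp, by simp⟩

theorem left_unique_of_right (h : IsTightBorder G s t b x) {a a' y : V} (hy : G.Adj t y)
    (ha : G.Adj s a) (ha' : G.Adj s a') (hay : G.Adj y a) (hay' : G.Adj y a') : a = a' := by
  by_contra hne
  have ht : ∀ z, G.Adj s z → z ≠ t := by
    rintro _ hz rfl
    exact h.minimal.not_adj_terminals hz
  refine h.not_winsFirst_within {y, a, a'} (Finset.card_le_three.trans (by norm_num)) ?_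
  refine winsFirst_of_fork (b := y) (u := a) (v := a') ⟨?_, hy.ne'⟩ ⟨ha.ne', ht a ha⟩
    ⟨ha'.ne', ht a' ha'⟩ hay.ne hay'.ne hne ?_ ?_
  · rintro rfl
    exact h.minimal.not_adj_terminals hy.symm
  · exact fun c h₁ h₂ => joined_of_path₂ h₂ h₁ ⟨ha, by simp, by simp⟩
      ⟨hay.symm, by simp, by simp⟩ ⟨hy.symm, by simp, by simp⟩
  · exact fun c h₁ h₂ => joined_of_path₂ h₂ h₁ ⟨ha', by simp, by simp⟩
      ⟨hay'.symm, by simp, by simp⟩ ⟨hy.symm, by simp, by simp⟩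

theorem ne_left (h : IsTightBorder G s t b x) {y : V} (hy : G.Adj t y) : y ≠ s := by
  rintro rfl
  exact h.minimal.not_adj_terminals hy.symm

theorem ne_right (h : IsTightBorder G s t b x) {a : V} (ha : G.Adj s a) : a ≠ t := by
  rintro rfl
  exact h.minimal.not_adj_terminals ha

theorem not_adj_left_of_right (h : IsTightBorder G s t b x) {y : V} (hy : G.Adj t y) :
    ¬ G.Adj s y := fun hs => h.not_adj_both hs hy

/-- Otherwise there is a delayed fork: Short takes `b`, Cut must answer at `x`, Short takes `c` and
threatens both `y` and `y'`. -/
theorem right_unique_of_centre (h : IsTightBorder G s t b x) {c y y' : V} (hcs : c ≠ s)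
    (hct : c ≠ t) (hsc : ¬ G.Adj s c) (htc : ¬ G.Adj t c)
    (hy : G.Adj t y) (hy' : G.Adj t y') (hyx : y ≠ x) (hyx' : y' ≠ x)
    (hcy : G.Adj c y) (hcy' : G.Adj c y') : y = y' := by
  by_contra hne
  have hbc := h.adj_centre c hcs hct hsc htc
  have hbne : ∀ z, G.Adj t z → b ≠ z := by
    rintro _ hz rfl
    exact h.not_adj_right hz
  refine h.not_winsFirst_within {b, x, c, y, y'} Finset.card_le_five ?_
  refine winsFirst_of_delayed_fork (b := b) (x := x) (d := c) (u := y) (v := y') ?_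
    ⟨h.ne_left hy, hy.ne'⟩ ⟨h.ne_left hy', hy'.ne'⟩ ⟨hcs, hct⟩ hbc.ne (hbne y hy) (hbne y' hy')
    hyx.symm hyx'.symm hcy.ne hcy'.ne hne (h.ne_right h.adj_left) (h.ne_left h.mate_adj_right)
    ⟨h.adj_left, by simp, by simp⟩ ⟨h.adj_mate, by simp, by simp⟩
    ⟨h.mate_adj_right.symm, by simp, by simp⟩ ?_ ?_
  · rintro rfl
    exact htc h.mate_adj_right
  · exact fun p h₁ h₂ h₃ => joined_of_path₃ h₁ h₂ h₃ ⟨h.adj_left, by simp, by simp⟩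
      ⟨hbc, by simp, by simp⟩ ⟨hcy, by simp, by simp⟩ ⟨hy.symm, by simp, by simp⟩
  · exact fun p h₁ h₂ h₃ => joined_of_path₃ h₁ h₂ h₃ ⟨h.adj_left, by simp, by simp⟩
      ⟨hbc, by simp, by simp⟩ ⟨hcy', by simp, by simp⟩ ⟨hy'.symm, by simp, by simp⟩

/-- Again a delayed fork: `b`, forced reply `x`, then `y` with threats at `v` and `v'`. -/
theorem not_right_unique (h : IsTightBorder G s t b x) {y v v' : V} (hy : G.Adj t y)
    (hyx : y ≠ x) (hv : v ≠ t) (hv' : v' ≠ t) (htv : ¬ G.Adj t v) (htv' : ¬ G.Adj t v')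
    (hyv : G.Adj y v) (hyv' : G.Adj y v') : v = v' := by
  by_contra hne
  have hs : ∀ z, G.Adj y z → z ≠ s := by
    rintro _ hz rfl
    exact h.not_adj_left_of_right hy hz.symm
  have hb : ∀ z, G.Adj y z → b ≠ z := by
    rintro _ hz rfl
    exact hyx (h.mate_unique y hz.symm hy)
  have hx : ∀ z, ¬ G.Adj t z → x ≠ z := by
    rintro _ hz rfl
    exact hz h.mate_adj_right
  have hby : b ≠ y := by
    rintro rfl
    exact h.not_adj_right hy
  have key : ∀ z ∈ ({b, x, y, v, v'} : Finset V), z ≠ t → ¬ G.Adj t z → G.Adj y z →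
      ∀ p : Position V, p b = some .short → p y = some .short → p z = some .short →
      Joined (within G {u | u = s ∨ u = t ∨ u ∈ ({b, x, y, v, v'} : Finset V)}) s t p := by
    intro z hzT hzt htz hyz p h₁ h₂ h₃
    -- Either `z` borders `s` and the path is `s`, `z`, `y`, `t`, or `z` is central, hence adjacent
    -- to `b`, and the path is `s`, `b`, `z`, `y`, `t`.
    by_cases hsz : G.Adj s z
    · exact joined_of_path₂ h₃ h₂ ⟨hsz, by simp, .inr (.inr hzT)⟩
        ⟨hyz.symm, .inr (.inr hzT), by simp⟩ ⟨hy.symm, by simp, by simp⟩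
    · exact joined_of_path₃ h₁ h₃ h₂ ⟨h.adj_left, by simp, by simp⟩
        ⟨h.adj_centre z (hs z hyz) hzt hsz htz, by simp, .inr (.inr hzT)⟩
        ⟨hyz.symm, .inr (.inr hzT), by simp⟩ ⟨hy.symm, by simp, by simp⟩
  refine h.not_winsFirst_within {b, x, y, v, v'} Finset.card_le_five ?_
  exact winsFirst_of_delayed_fork (b := b) (x := x) (d := y) (u := v) (v := v') hyx.symm
    ⟨hs v hyv, hv⟩ ⟨hs v' hyv', hv'⟩ ⟨h.ne_left hy, hy.ne'⟩ hby (hb v hyv) (hb v' hyv')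
    (hx v htv) (hx v' htv') hyv.ne hyv'.ne hne (h.ne_right h.adj_left)
    (h.ne_left h.mate_adj_right)
    ⟨h.adj_left, by simp, by simp⟩ ⟨h.adj_mate, by simp, by simp⟩
    ⟨h.mate_adj_right.symm, by simp, by simp⟩
    (key v (by simp) hv htv hyv)
    (key v' (by simp) hv' htv' hyv')

/-! ### Exclusion of every winning first move -/

/-- A winning first move has several neighbours out of the reach of a terminal. -/
theorem not_droppable (h : IsTightBorder G s t b x) {m r w : V} (hms : m ≠ s) (hmt : m ≠ t)
    (hm : Forces G s t .short .cut (Function.update (fun _ => none) m (some .short)))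
    (hmw : G.Adj m w) (hr : r = s ∨ r = t)
    (hplay : ∀ v, G.Adj m v → v ≠ r → ¬ G.Adj r v → v ≠ s ∧ v ≠ t)
    (huniq : ∀ v v', G.Adj m v → v ≠ r → ¬ G.Adj r v → G.Adj m v' → v' ≠ r → ¬ G.Adj r v' →
      v = v') : False := by
  obtain ⟨u, hus, hut, hum⟩ := exists_nonterminal_notMem (s := s) (t := t) {m}
    (by have := h.weight_lt; simp; omega)
  refine h.minimal.2 s(m, w) hmw (Forces.drop_move (r := r) ⟨hms, hmt, rfl⟩
    ⟨u, by simpa using hum, hus, hut, rfl⟩ ?_ (hr.imp id Or.inl) ?_ huniq hm)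
  · rcases hr with rfl | rfl
    exacts [hms.symm, hmt.symm]
  · exact fun v h₁ h₂ h₃ => ⟨(hplay v h₁ h₂ h₃).1, (hplay v h₁ h₂ h₃).2, rfl⟩

/-- If `m` had a central neighbour `v`, the edge from `b` to `v` would be bypassed through `s` and
`m`. So beyond the reach of `s` the move `m` only meets the border of `t`, in at most one vertex. -/
theorem left_not_winning (h : IsTightBorder G s t b x) {m : V} (hsm : G.Adj s m) (hmb : m ≠ b)
    (hm : Forces G s t .short .cut (Function.update (fun _ => none) m (some .short))) :
    False := by
  have hmt := h.ne_right hsm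
  have hvt : ∀ v, G.Adj m v → v ≠ t := by
    rintro _ hv rfl
    exact h.not_adj_both hsm hv.symm
  have hB : ∀ v, G.Adj m v → v ≠ s → ¬ G.Adj s v → G.Adj t v := by
    intro v hv hvs hsv
    by_contra htv
    have hbv := h.adj_centre v hvs (hvt v hv) hsv htv
    refine h.minimal.not_superfluous hm ⟨hsm.ne', hmt⟩ hbv fun c hc K hK _ hub huv => .inl ?_
    have h1 := hK.mem_iff (.inl rfl) hub (deleteEdge_adj h.adj_left
      (fun e => h.adj_left.ne e.1) (fun e => hvs e.1.symm))
    have h2 := hK.mem_iff (.inl rfl) (.inr (.inr hc)) (deleteEdge_adj hsm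
      (fun e => h.adj_left.ne e.1) (fun e => hvs e.1.symm))
    have h3 := hK.mem_iff (.inr (.inr hc)) huv (deleteEdge_adj hv
      (fun e => hmb e.1) (fun e => hv.ne e.1))
    exact h1.symm.trans (h2.trans h3)
  exact h.not_droppable hsm.ne' hmt hm hsm.symm (.inl rfl)
    (fun v h₁ h₂ _ => ⟨h₂, hvt v h₁⟩)
    (fun v v' h₁ h₂ h₃ h₁' h₂' h₃' =>
      h.right_unique_of_left hsm (hB v h₁ h₂ h₃) (hB v' h₁' h₂' h₃') h₁ h₁')

/-- Since `m` is adjacent to `b`, a common neighbour `v` of both would make the edge from `b` to `v`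
superfluous. This rules out `x` and central vertices as neighbours of `m`. -/
theorem centre_not_winning (h : IsTightBorder G s t b x) {m : V} (hms : m ≠ s) (hmt : m ≠ t)
    (hsm : ¬ G.Adj s m) (htm : ¬ G.Adj t m)
    (hm : Forces G s t .short .cut (Function.update (fun _ => none) m (some .short))) :
    False := by
  have hbm := h.adj_centre m hms hmt hsm htm
  have htri : ∀ v, G.Adj m v → ¬ G.Adj b v := by
    intro v hv hbv
    refine h.minimal.not_superfluous hm ⟨hms, hmt⟩ hbv fun c hc K hK _ hub huv => .inl ?_
    have h1 := hK.mem_iff hub (.inr (.inr hc)) (deleteEdge_adj hbm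
      (fun e => hv.ne e.2) (fun e => hbm.ne e.2.symm))
    have h2 := hK.mem_iff (.inr (.inr hc)) huv (deleteEdge_adj hv
      (fun e => hbm.ne e.1.symm) (fun e => hv.ne e.1))
    exact h1.trans h2
  have hvt : ∀ v, G.Adj m v → v ≠ t := by
    rintro _ hv rfl
    exact htm hv.symm
  have hB : ∀ v, G.Adj m v → v ≠ s → ¬ G.Adj s v → G.Adj t v := fun v hv hvs hsv =>
    by_contra fun htv => htri v hv (h.adj_centre v hvs (hvt v hv) hsv htv)
  have hx : ∀ v, G.Adj m v → v ≠ x := by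
    rintro _ hv rfl
    exact htri _ hv h.adj_mate
  exact h.not_droppable hms hmt hm hbm.symm (.inl rfl)
    (fun v h₁ h₂ _ => ⟨h₂, hvt v h₁⟩)
    (fun v v' h₁ h₂ h₃ h₁' h₂' h₃' =>
      h.right_unique_of_centre hms hmt hsm htm (hB v h₁ h₂ h₃) (hB v' h₁' h₂' h₃')
        (hx v h₁) (hx v' h₁') h₁ h₁')

theorem right_not_winning (h : IsTightBorder G s t b x) {m : V} (htm : G.Adj t m) (hmx : m ≠ x)
    (hm : Forces G s t .short .cut (Function.update (fun _ => none) m (some .short))) :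
    False := by
  refine h.not_droppable (h.ne_left htm) htm.ne' hm htm.symm (.inr rfl) ?_
    (fun v v' h₁ h₂ h₃ h₁' h₂' h₃' => h.not_right_unique htm hmx h₂ h₂' h₃ h₃' h₁ h₁')
  refine fun v h₁ h₂ _ => ⟨?_, h₂⟩
  rintro rfl
  exact h.not_adj_left_of_right htm h₁.symm

/-- Once `x` is Short's, taking `b` already joins the terminals, so an edge from `b` to a central
neighbour of `x` is superfluous. Beyond the reach of `t`, only the border of `s` remains. -/
theorem mate_not_winning (h : IsTightBorder G s t b x)
    (hm : Forces G s t .short .cut (Function.update (fun _ => none) x (some .short))) :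
    False := by
  have hxs := h.ne_left h.mate_adj_right
  have hxt := h.mate_adj_right.ne'
  have hbt := h.ne_right h.adj_left
  have hs : ∀ v, G.Adj x v → v ≠ s := by
    rintro _ hv rfl
    exact h.not_adj_left_of_right h.mate_adj_right hv.symm
  have hA : ∀ v, G.Adj x v → v ≠ t → ¬ G.Adj t v → G.Adj s v := by
    intro v hv hvt htv
    by_contra hsv
    have hbv := h.adj_centre v (hs v hv) hvt hsv htv
    refine h.minimal.not_superfluous hm ⟨hxs, hxt⟩ hbv fun c hc K hK hsK hub huv => .inr ?_
    have h1 := hK.mem_iff (.inl rfl) hub (deleteEdge_adj h.adj_left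
      (fun e => h.adj_left.ne e.1) (fun e => hs v hv e.1.symm))
    have h2 := hK.mem_iff hub (.inr (.inr hc)) (deleteEdge_adj h.adj_mate
      (fun e => hv.ne e.2) (fun e => h.adj_mate.ne e.2.symm))
    have h3 := hK.mem_iff (.inr (.inr hc)) (.inr (.inl rfl)) (deleteEdge_adj
      h.mate_adj_right.symm (fun e => hvt e.2.symm) (fun e => hbt e.2.symm))
    exact h3.1 (h2.1 (h1.1 hsK))
  exact h.not_droppable hxs hxt hm h.mate_adj_right.symm (.inr rfl)
    (fun v h₁ h₂ _ => ⟨hs v h₁, h₂⟩)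
    (fun v v' h₁ h₂ h₃ h₁' h₂' h₃' =>
      h.left_unique_of_right h.mate_adj_right (hA v h₁ h₂ h₃) (hA v' h₁' h₂' h₃') h₁ h₁')

/-- The opening `b` cannot itself be dropped, so the argument moves one exchange later: Cut answers
at `x`, and Short's next winning move `m` is shown to be idle. -/
theorem border_not_winning (h : IsTightBorder G s t b x)
    (hm : Forces G s t .short .cut (Function.update (fun _ => none) b (some .short))) :
    False := by
  have hbs := h.adj_left.ne'
  have hbt := h.ne_right h.adj_left
  have hxs := h.ne_left h.mate_adj_right
  have hxt := h.mate_adj_right.ne'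
  have hbx := h.adj_mate.ne
  have hAC : ∀ a v, G.Adj s a → a ≠ b → v ≠ s → v ≠ t → ¬ G.Adj s v → ¬ G.Adj t v →
      ¬ G.Adj a v := by
    intro a v ha hab hvs hvt hsv htv hav
    have hbv := h.adj_centre v hvs hvt hsv htv
    refine h.minimal.not_superfluous hm ⟨hbs, hbt⟩ hav fun c hc K hK _ hua huv => .inl ?_
    have h1 := hK.mem_iff (.inl rfl) hua (deleteEdge_adj ha
      (fun e => ha.ne e.1) (fun e => hvs e.1.symm))
    have h2 := hK.mem_iff (.inl rfl) (.inr (.inr hc)) (deleteEdge_adj h.adj_left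
      (fun e => ha.ne e.1) (fun e => hvs e.1.symm))
    have h3 := hK.mem_iff (.inr (.inr hc)) huv (deleteEdge_adj hbv
      (fun e => hab e.1.symm) (fun e => hbv.ne e.1))
    exact h1.symm.trans (h2.trans h3)
  have hrep := hm.reply (z := x) ⟨hxs, hxt, by simp [hbx.symm]⟩
  set c := Function.update (Function.update (fun _ => none : Position V) b (some .short)) x
    (some .cut) with hc
  have hcb : c b = some .short := by simp [hc, hbx]
  have hplay : ∀ v, v ≠ s → v ≠ t → v ≠ b → v ≠ x → Playable s t c v := fun v h₁ h₂ h₃ h₄ =>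
    ⟨h₁, h₂, by simp [hc, h₃, h₄]⟩
  have hfree : ∀ T : Finset V, T.card ≤ 5 → b ∈ T → x ∈ T → ∃ u, u ∉ T ∧ Playable s t c u := by
    intro T hT hbT hxT
    obtain ⟨u, hus, hut, hu⟩ := exists_nonterminal_notMem (s := s) (t := t) T
      (lt_of_le_of_lt hT h.weight_lt)
    exact ⟨u, hu, hplay u hus hut (fun e => hu (e ▸ hbT)) (fun e => hu (e ▸ hxT))⟩
  obtain ⟨m, hmp, hmw⟩ := hrep.exists_move
    ((hfree {b, x} (Finset.card_le_two.trans (by norm_num)) (by simp) (by simp)).imp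
      fun _ => And.right)
  have hmb : m ≠ b := by
    rintro rfl
    exact absurd hmp.2.2 (by simp [hcb])
  have hmx : m ≠ x := by
    rintro rfl
    exact absurd hmp.2.2 (by simp [hc])
  have hfree' : ∃ u, u ≠ m ∧ Playable s t c u :=
    (hfree {b, x, m} (Finset.card_le_three.trans (by norm_num)) (by simp) (by simp)).imp
      fun u hu => ⟨by rintro rfl; simp at hu, hu.2⟩
  -- The path `s`, `b`, `x`, `t` avoids `m`, so without an edge at `m` the opening `b` still forces
  -- Cut to `x`.
  have hfin : ∀ w, G.Adj m w →
      ¬ Forces (G.deleteEdges {s(m, w)}) s t .short .short c := by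
    intro w hw hF
    refine h.minimal.2 s(m, w) hw (.ownMove _ b ⟨hbs, hbt, rfl⟩ (forces_of_threat (u := x)
      ⟨hxs, hxt, by simp [hbx.symm]⟩ (joined_of_path₂ (u := b) (v := x) (by simp [hbx])
        (by simp) ?_ ?_ ?_) hF))
    · exact deleteEdge_adj h.adj_left (fun e => hmp.1 e.1.symm) (fun e => hmb e.2.symm)
    · exact deleteEdge_adj h.adj_mate (fun e => hmb e.1.symm) (fun e => hmx e.2.symm)
    · exact deleteEdge_adj h.mate_adj_right.symm (fun e => hmx e.1.symm)
        (fun e => hmp.2.1 e.2.symm)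
  by_cases hsm : G.Adj s m
  · have hB : ∀ v, G.Adj m v → v ≠ s → ¬ G.Adj s v → v ≠ t ∧ G.Adj t v := by
      intro v hv hvs hsv
      have hvt : v ≠ t := by
        rintro rfl
        exact h.not_adj_both hsm hv.symm
      exact ⟨hvt, by_contra fun htv => hAC m v hsm hmb hvs hvt hsv htv hv⟩
    refine hfin s hsm.symm (Forces.drop_move (r := s) hmp hfree' hmp.1.symm (.inl rfl) ?_ ?_ hmw)
    -- Cut's reply must be uncoloured. It is not `x`, which would otherwise have both `m` and `b` as
    -- neighbours in the border of `s`.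
    · refine fun v h₁ h₂ h₃ => hplay v h₂ (hB v h₁ h₂ h₃).1 ?_ ?_
      · rintro rfl
        exact h₃ h.adj_left
      · rintro rfl
        exact hmb (h.left_unique_of_right h.mate_adj_right hsm h.adj_left h₁.symm
          h.adj_mate.symm)
    · exact fun v v' h₁ h₂ h₃ h₁' h₂' h₃' =>
        h.right_unique_of_left hsm (hB v h₁ h₂ h₃).2 (hB v' h₁' h₂' h₃').2 h₁ h₁'
  by_cases htm : G.Adj t m
  · refine hfin t htm.symm (Forces.drop_move (r := t) hmp hfree' hmp.2.1.symm (.inr (.inl rfl))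
      ?_ ?_ hmw)
    · refine fun v h₁ h₂ h₃ => hplay v ?_ h₂ ?_ ?_
      · rintro rfl
        exact hsm h₁.symm
      · rintro rfl
        exact hmx (h.mate_unique m h₁.symm htm)
      · rintro rfl
        exact h₃ h.mate_adj_right
    · exact fun v v' h₁ h₂ h₃ h₁' h₂' h₃' => h.not_right_unique htm hmx h₂ h₂' h₃ h₃' h₁ h₁'
  -- For a central `m` the bypass runs through `b`, which now belongs to Short.
  have hbm := h.adj_centre m hmp.1 hmp.2.1 hsm htm
  have hB : ∀ v, G.Adj m v → v ≠ b → ¬ G.Adj b v → v ≠ s ∧ v ≠ t ∧ v ≠ x ∧ G.Adj t v := by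
    intro v hv hvb hbv
    have hvs : v ≠ s := by
      rintro rfl
      exact hsm hv.symm
    have hvt : v ≠ t := by
      rintro rfl
      exact htm hv.symm
    have hvx : v ≠ x := by
      rintro rfl
      exact hbv h.adj_mate
    have hsv : ¬ G.Adj s v := fun hsv =>
      hAC v m hsv hvb hmp.1 hmp.2.1 hsm htm hv.symm
    exact ⟨hvs, hvt, hvx, by_contra fun htv => hbv (h.adj_centre v hvs hvt hsv htv)⟩
  refine hfin b hbm.symm (Forces.drop_move (r := b) hmp hfree' hmb.symm (.inr (.inr hcb)) ?_ ?_
    hmw)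
  · intro v h₁ h₂ h₃
    obtain ⟨hvs, hvt, hvx, -⟩ := hB v h₁ h₂ h₃
    exact hplay v hvs hvt h₂ hvx
  · intro v v' h₁ h₂ h₃ h₁' h₂' h₃'
    obtain ⟨-, -, hvx, htv⟩ := hB v h₁ h₂ h₃
    obtain ⟨-, -, hvx', htv'⟩ := hB v' h₁' h₂' h₃'
    exact h.right_unique_of_centre hmp.1 hmp.2.1 hsm htm htv htv' hvx hvx' h₁ h₁'

theorem elim (h : IsTightBorder G s t b x) : False := by
  obtain ⟨m, hmp, hm⟩ := Forces.exists_move h.minimal.1.1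
    ⟨b, h.adj_left.ne', h.ne_right h.adj_left, rfl⟩
  by_cases hmb : m = b
  · exact h.border_not_winning (hmb ▸ hm)
  by_cases hmx : m = x
  · exact h.mate_not_winning (hmx ▸ hm)
  by_cases hsm : G.Adj s m
  · exact h.left_not_winning hsm hmb hm
  by_cases htm : G.Adj t m
  · exact h.right_not_winning htm hmx hm
  exact h.centre_not_winning hmp.1 hmp.2.1 hsm htm hm

end IsTightBorder

/-! ### Counting the neighbours of `b` -/

/-- If all edges have their ends in `T` or at the terminals, then the non-terminal vertices outside
`T` belong to the centre. -/
theorem weight_le_card_add_centreSize [DecidableRel G.Adj] (T : Finset V)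
    (hT : ∀ u v, G.Adj u v → v = s ∨ v = t ∨ v ∈ T) :
    weight s t ≤ T.card + centreSize G s t := by
  refine (Finset.card_le_card fun u hu => ?_).trans (Finset.card_union_le _ _)
  simp only [Finset.mem_filter, Finset.mem_univ, true_and, Finset.mem_union] at hu ⊢
  by_cases huT : u ∈ T
  · exact .inl huT
  · have : ∀ v, ¬ G.Adj v u := by
      intro v hv
      rcases hT v u hv with h | h | h
      exacts [hu.1 h, hu.2 h, huT h]
    exact .inr ⟨hu.1, hu.2, this s, this t⟩

theorem degree_le_of_adj_left [DecidableRel G.Adj] (hG : IsMinimalWeakLink G s t) {b : V}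
    (hsb : G.Adj s b) :
    (3 < weight s t → G.degree b ≤ centreSize G s t + 2) ∧
      (5 < weight s t → G.degree b ≤ centreSize G s t + 1) := by
  have hbt : b ≠ t := by
    rintro rfl
    exact hG.not_adj_terminals hsb
  -- Here `d_b ≤ 2` and `w ≤ p + 1`.
  by_cases htb : G.Adj t b
  · have hw : WinsFirst (within G {v | v = s ∨ v = t ∨ v ∈ ({b} : Finset V)}) s t .short :=
      winsFirst_of_common_neighbour (b := b) ⟨hsb, by simp, by simp⟩
        ⟨htb.symm, by simp, by simp⟩
    have hT := fun u v (huv : G.Adj u v) => hG.mem_of_adj hw huv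
    have h1 := weight_le_card_add_centreSize _ hT
    have h2 : G.degree b ≤ 2 := by
      rw [← SimpleGraph.card_neighborFinset_eq_degree]
      refine (Finset.card_le_card (t := {s, t}) fun v hv => ?_).trans Finset.card_le_two
      rw [SimpleGraph.mem_neighborFinset] at hv
      have := hT b v hv
      simp only [Set.mem_ofPred_eq, Finset.mem_singleton] at this
      simpa [hv.ne'] using this
    rw [Finset.card_singleton] at h1
    omega
  -- In the fork case `d_b ≤ 3` and `w ≤ p + 3`, so `w > 3` gives `p ≥ 1` and `w > 5` gives `p ≥ 3`.
  by_cases hfork : ∃ y y', y ≠ y' ∧ G.Adj b y ∧ G.Adj b y' ∧ G.Adj t y ∧ G.Adj t y'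
  · obtain ⟨y, y', hne, hby, hby', hty, hty'⟩ := hfork
    have hs : ∀ z, G.Adj t z → z ≠ s := by
      rintro _ hz rfl
      exact hG.not_adj_terminals hz.symm
    have hw : WinsFirst (within G {v | v = s ∨ v = t ∨ v ∈ ({b, y, y'} : Finset V)}) s t
        .short := by
      refine winsFirst_of_fork (b := b) (u := y) (v := y') ⟨hsb.ne', hbt⟩ ⟨hs y hty, hty.ne'⟩
        ⟨hs y' hty', hty'.ne'⟩ hby.ne hby'.ne hne ?_ ?_
      · exact fun c h₁ h₂ => joined_of_path₂ h₁ h₂ ⟨hsb, by simp, by simp⟩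
          ⟨hby, by simp, by simp⟩ ⟨hty.symm, by simp, by simp⟩
      · exact fun c h₁ h₂ => joined_of_path₂ h₁ h₂ ⟨hsb, by simp, by simp⟩
          ⟨hby', by simp, by simp⟩ ⟨hty'.symm, by simp, by simp⟩
    have hT := fun u v (huv : G.Adj u v) => hG.mem_of_adj hw huv
    have h1 := weight_le_card_add_centreSize _ hT
    have h2 : G.degree b ≤ 3 := by
      rw [← SimpleGraph.card_neighborFinset_eq_degree]
      refine (Finset.card_le_card (t := {s, y, y'}) fun v hv => ?_).trans Finset.card_le_three
      rw [SimpleGraph.mem_neighborFinset] at hv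
      have := hT b v hv
      have hvt : v ≠ t := by
        rintro rfl
        exact htb hv.symm
      simp only [Set.mem_ofPred_eq, Finset.mem_insert, Finset.mem_singleton] at this
      simpa [hv.ne', hvt] using this
    have h3 : ({b, y, y'} : Finset V).card ≤ 3 := Finset.card_le_three
    omega
  push Not at hfork
  have hnb : ∀ v, G.Adj b v → v ≠ s → ¬ G.Adj t v →
      v ≠ s ∧ v ≠ t ∧ ¬ G.Adj s v ∧ ¬ G.Adj t v := by
    intro v hv hvs htv
    refine ⟨hvs, ?_, fun hsv => hG.not_adj_of_adj_left hsb hsv hv, htv⟩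
    rintro rfl
    exact htb hv.symm
  set C := Finset.univ.filter fun v : V => v ≠ s ∧ v ≠ t ∧ ¬ G.Adj s v ∧ ¬ G.Adj t v with hC
  have hCc : C.card = centreSize G s t := rfl
  by_cases hx : ∃ x, G.Adj b x ∧ G.Adj t x
  · obtain ⟨x, hbx, htx⟩ := hx
    have huniq : ∀ v, G.Adj b v → G.Adj t v → v = x := fun v h₁ h₂ =>
      by_contra fun hne => hfork v x hne h₁ hbx h₂ htx
    have hsub : ∀ v, G.Adj b v → v = s ∨ v = x ∨ v ∈ C := by
      intro v hv
      by_cases hvs : v = s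
      · exact .inl hvs
      by_cases htv : G.Adj t v
      · exact .inr (.inl (huniq v hv htv))
      · exact .inr (.inr (by simpa [hC] using hnb v hv hvs htv))
    constructor
    · intro _
      rw [← SimpleGraph.card_neighborFinset_eq_degree, ← hCc]
      refine (Finset.card_le_card (t := insert s (insert x C)) fun v hv => ?_).trans
        ((Finset.card_insert_le _ _).trans (Nat.succ_le_succ (Finset.card_insert_le _ _)))
      rw [SimpleGraph.mem_neighborFinset] at hv
      simpa only [Finset.mem_insert] using hsub v hv
    · intro hw
      by_cases hall : ∀ v ∈ C, G.Adj b v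
      · refine (IsTightBorder.elim (G := G) (s := s) (t := t) (b := b) (x := x)
          ⟨hG, hsb, htb, hbx, htx, huniq, fun v h₁ h₂ h₃ h₄ => hall v ?_, hw⟩).elim
        simp [hC, h₁, h₂, h₃, h₄]
      -- A central vertex `u` not adjacent to `b` lowers the bound `p + 2` by one.
      · push Not at hall
        obtain ⟨u, huC, hbu⟩ := hall
        rw [← SimpleGraph.card_neighborFinset_eq_degree, ← hCc,
          ← Finset.card_erase_add_one huC]
        refine (Finset.card_le_card (t := insert s (insert x (C.erase u))) fun v hv => ?_).trans
          ((Finset.card_insert_le _ _).trans (Nat.succ_le_succ (Finset.card_insert_le _ _)))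
        rw [SimpleGraph.mem_neighborFinset] at hv
        have hvu : v ≠ u := by
          rintro rfl
          exact hbu hv
        simpa only [Finset.mem_insert, Finset.mem_erase, hvu, ne_eq, not_false_eq_true,
          true_and] using hsub v hv
  · have h1 : G.degree b ≤ centreSize G s t + 1 := by
      rw [← SimpleGraph.card_neighborFinset_eq_degree, ← hCc]
      refine (Finset.card_le_card (t := insert s C) fun v hv => ?_).trans
        (Finset.card_insert_le _ _)
      rw [SimpleGraph.mem_neighborFinset] at hv
      by_cases hvs : v = s
      · simp [hvs]
      · exact Finset.mem_insert_of_mem (by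
          simpa [hC] using hnb v hv hvs fun htv => hx ⟨v, hv, htv⟩)
    exact ⟨fun _ => h1.trans (Nat.le_succ _), fun _ => h1⟩

theorem weight_comm : weight s t = weight t s := by
  unfold weight
  congr 1
  ext v
  simp [and_comm]

theorem centreSize_comm [DecidableRel G.Adj] : centreSize G s t = centreSize G t s := by
  unfold centreSize
  congr 1
  ext v
  simp only [Finset.mem_filter, Finset.mem_univ, true_and]
  tauto

end ShannonGame

theorem mainTheorem3 {V : Type*} [Fintype V] [DecidableEq V] (G : SimpleGraph V)
    [DecidableRel G.Adj] (s t : V) (hst : s ≠ t)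
    (hG : ShannonGame.IsMinimalWeakLink G s t) (b : V) (hb : ShannonGame.IsBorder G s t b) :
    (3 < ShannonGame.weight s t → G.degree b ≤ ShannonGame.centreSize G s t + 2) ∧
      (5 < ShannonGame.weight s t → G.degree b ≤ ShannonGame.centreSize G s t + 1) := by
  rcases hb with hb | hb
  · exact ShannonGame.degree_le_of_adj_left hG hb
  · rw [ShannonGame.weight_comm, ShannonGame.centreSize_comm]
    exact ShannonGame.degree_le_of_adj_left hG.swap hb
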